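/- Let $\alpha^+,\lambda^+,\alpha^-,\lambda^->0$, $r\ge q\ge 0$ and $S_0>0$. Let $(\Omega,\mathcal F,(\mathcal F_t)_{t\ge0},\mathbb P)$ be a filtered probability space and $X=(X_t)_{t\ge0}$ a bilateral Gamma process on it, $X\sim\Gamma(\alpha^+,\lambda^+;\alpha^-,\lambda^-)$: that is, $X$ is a real-valued càdlàg Lévy process with respect to $(\mathcal F_t)$ such that $X_1$ has the law of $Y-Z$ with independent $Y\sim\Gamma(\alpha^+,\lambda^+)$ and $Z\sim\Gamma(\alpha^-,\lambda^-)$ (shape and rate parameters). Let $T\in(0,\infty]$ be a time horizon. For $\Theta\in(-\lambda^-,\lambda^+)$ let $\mathbb P^\Theta$ denote the Esscher transform of $\mathbb P$, i.e. a probability measure with $$\frac{d\mathbb P^\Theta}{d\mathbb P}\Big|_{\mathcal F_t}=e^{\Theta X_t-\Psi(\Theta)t}\quad\text{for all finite } t\in[0,T],\qquad \Psi(z)=\ln\mathbb E[e^{zX_1}].$$ (For $T=\infty$ it is assumed that these measures exist on $(\Omega,\mathcal F)$.) A probability measure $\mathbb Q$ is called a martingale measure if it is equivalent to $\mathbb P$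 on $\mathcal F_t$ for every finite $t\in[0,T]$ and the discounted price process $\tilde S_t=S_0e^{X_t-(r-q)t}$, stopped at $T$, is a local $\mathbb Q$-martingale. Let $$I=\Big(\lambda^+-\big(1-e^{-(r-q)/\alpha^+}\big)^{-1},\ \lambda^+-1\Big),$$ where the left end point is read as $-\infty$ if $r=q$, and for $\theta\in I$ let $$\Phi(\theta)=\lambda^--\Bigg(\bigg(\Big(\frac{\lambda^+-\theta}{\lambda^+-\theta-1}\Big)^{\alpha^+}e^{-(r-q)}\bigg)^{1/\alpha^-}-1\Bigg)^{-1}.$$ Suppose that $\lambda^++\lambda^->1$. Then $\Phi$ is a strictly increasing function from $I$ to $(-\infty,\lambda^-)$, there is exactly one $\Theta\in(-\lambda^-,\lambda^+)$ such that $\mathbb P^\Theta$ is a martingale measure, this $\Theta$ lies in $(-\lambda^-,\lambda^+-1)$, and it is the unique solution of the equation $$\Phi(\Theta)=-\Theta,\qquad \Theta\in I.$$ -/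

import Mathlib

open MeasureTheory ProbabilityTheory Filter Set
open scoped NNReal ENNReal Topology

noncomputable section

/-- The bilateral Gamma distribution `Γ(α⁺, λ⁺; α⁻, λ⁻)`: the law of `Y - Z`, where `Y` and `Z` are
independent, `Y ∼ Γ(α⁺, λ⁺)` and `Z ∼ Γ(α⁻, λ⁻)` (shape and rate parameters). -/
def bilateralGamma (αp lamp αm lamm : ℝ) : Measure ℝ :=
  ((gammaMeasure αp lamp).prod (gammaMeasure αm lamm)).map (fun y => y.1 - y.2)

/-- Real-valued Lévy processes on a filtered probability space `(Ω, 𝓕, P)`. -/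
structure IsLevyProcess {Ω : Type*} {mΩ : MeasurableSpace Ω} (𝓕 : Filtration ℝ≥0 mΩ)
    (P : Measure Ω) (X : ℝ≥0 → Ω → ℝ) : Prop where
  adapted : StronglyAdapted 𝓕 X
  zero : ∀ᵐ ω ∂P, X 0 ω = 0
  right_continuous : ∀ ω t, ContinuousWithinAt (fun s => X s ω) (Ici t) t
  left_limits : ∀ ω t, ∃ l : ℝ, Tendsto (fun s => X s ω) (𝓝[<] t) (𝓝 l)
  indep_increments : ∀ s h : ℝ≥0,
    Indep (𝓕 s) (MeasurableSpace.comap (fun ω => X (s + h) ω - X s ω) inferInstance) P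
  stationary_increments : ∀ s h : ℝ≥0,
    P.map (fun ω => X (s + h) ω - X s ω) = P.map (fun ω => X h ω - X 0 ω)

/-- `X ∼ Γ(α⁺, λ⁺; α⁻, λ⁻)` under `P`: the process `X` is a Lévy process and `X₁` has a bilateral
Gamma distribution. -/
structure IsBilateralGammaProcess {Ω : Type*} {mΩ : MeasurableSpace Ω} (𝓕 : Filtration ℝ≥0 mΩ)
    (P : Measure Ω) (X : ℝ≥0 → Ω → ℝ) (αp lamp αm lamm : ℝ) : Prop where
  levy : IsLevyProcess 𝓕 P X
  law_one : P.map (X 1) = bilateralGamma αp lamp αm lamm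

/-- The discounted stock price `e^{-(r-q)t} S_t`, where `S_t = S₀ e^{X_t}`. -/
def discountedPrice {Ω : Type*} (S₀ r q : ℝ) (X : ℝ≥0 → Ω → ℝ) (t : ℝ≥0) (ω : Ω) : ℝ :=
  Real.exp (-(r - q) * t) * (S₀ * Real.exp (X t ω))

/-- The probability measure `Q` is locally equivalent to `P` up to the horizon `T`. -/
def IsLocallyEquivalent {Ω : Type*} {mΩ : MeasurableSpace Ω} (𝓕 : Filtration ℝ≥0 mΩ)
    (T : WithTop ℝ≥0) (Q P : Measure Ω) : Prop :=
  ∀ t : ℝ≥0, (t : WithTop ℝ≥0) ≤ T → ∀ A, MeasurableSet[𝓕 t] A → (Q A = 0 ↔ P A = 0)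

/-- `Y` is a local `Q`-martingale. -/
def IsLocalMartingale {Ω : Type*} {mΩ : MeasurableSpace Ω} (𝓕 : Filtration ℝ≥0 mΩ)
    (Q : Measure Ω) (Y : ℝ≥0 → Ω → ℝ) : Prop :=
  Locally (fun Z => Martingale Z 𝓕 Q) 𝓕 Y Q

/-- `Q` is a (local) martingale measure for the price process `Y` with time horizon `T`: a
probability measure, locally equivalent to `P`, under which `(Y_{t ∧ T})` is a local martingale.
For `T = ⊤` the stopped process is `Y` itself. -/
structure IsMartingaleMeasure {Ω : Type*} {mΩ : MeasurableSpace Ω} (𝓕 : Filtration ℝ≥0 mΩ)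
    (T : WithTop ℝ≥0) (P : Measure Ω) (Y : ℝ≥0 → Ω → ℝ) (Q : Measure Ω) : Prop where
  isProbabilityMeasure : IsProbabilityMeasure Q
  locallyEquivalent : IsLocallyEquivalent 𝓕 T Q P
  localMartingale : IsLocalMartingale 𝓕 Q (stoppedProcess Y (fun _ => T))

/-- `Q` is the Esscher transform `P^Θ` with time horizon `T`: the probability measure whose
restriction to `𝓕 t` has density `exp (Θ X_t - Ψ(Θ) t)` with respect to that of `P`, for all
`t ≥ 0` with `t ≤ T`. Here `Ψ(z) = log E[exp (z X₁)]` is the cumulant generating function of `X₁`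
under `P`. -/
structure IsEsscherTransform {Ω : Type*} {mΩ : MeasurableSpace Ω} (𝓕 : Filtration ℝ≥0 mΩ)
    (T : WithTop ℝ≥0) (P : Measure Ω) (X : ℝ≥0 → Ω → ℝ) (Θ : ℝ) (Q : Measure Ω) : Prop where
  isProbabilityMeasure : IsProbabilityMeasure Q
  density : ∀ t : ℝ≥0, (t : WithTop ℝ≥0) ≤ T → ∀ A, MeasurableSet[𝓕 t] A →
    Q A = ∫⁻ ω in A, ENNReal.ofReal (Real.exp (Θ * X t ω - cgf (X 1) P Θ * t)) ∂P

/-- The interval `(λ⁺ - (1 - exp (-(r - q) / α⁺))⁻¹, λ⁺ - 1)`, whose left end point is `-∞` by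
convention if `r = q`. -/
def phiDomain (αp lamp r q : ℝ) : Set ℝ :=
  {θ | (r = q ∨ lamp - (1 - Real.exp (-((r - q) / αp)))⁻¹ < θ) ∧ θ < lamp - 1}

/-- The function `Φ`; it is only used on `phiDomain αp lamp r q`. -/
def phi (αp lamp αm lamm r q θ : ℝ) : ℝ :=
  lamm -
    ((((lamp - θ) / (lamp - θ - 1)) ^ αp * Real.exp (-(r - q))) ^ (1 / αm) - 1)⁻¹

end

/-! Everything reduces to the martingale equation `Ψ(Θ + 1) - Ψ(Θ) = r - q`. On `𝓕 t` the measure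
with density `exp (X_t - κ t)`, `κ = Ψ(Θ + 1) - Ψ(Θ)`, relative to `P^Θ` is `P^(Θ + 1)`. So `N_t =
exp (X_t - κ t)` is a `P^Θ`-martingale, and the discounted price is `S₀ exp ((κ - (r - q)) t) N_t`.
If `κ = r - q`, this is a true martingale.

Conversely, let the price be a local martingale under `P^Θ`. Being nonnegative, it has expectation
at most `S₀`. This excludes `Θ + 1 ≥ λ⁺`, where the expectation is infinite, and gives `κ ≤ r - q`.
If `κ < r - q`, optional stopping of `N` shows that each localizing time is a.s. zero, which is
absurd (`IsEsscherTransform.cgf_sub_eq_of_isMartingaleMeasure`).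

For the explicit bilateral Gamma cumulant function, the equation is equivalent to `Φ(Θ) = -Θ` on `I`
(`phi_eq_neg_iff`). A root exists because the left side runs from `-∞` to `∞` on `(-λ⁻, λ⁺ - 1)`. It
is unique because `Φ` increases while `-Θ` decreases. -/

/-! ### Exponential moments of Gamma and bilateral Gamma laws -/

/-- Tilting the `Γ(a, r)` density by `exp (z y)` gives a constant times the `Γ(a, r - z)` density,
which has mass one. -/
lemma lintegral_exp_gammaMeasure_of_lt {a r z : ℝ} (ha : 0 < a) (hr : 0 < r) (hz : z < r) :
    ∫⁻ y, ENNReal.ofReal (Real.exp (z * y)) ∂(gammaMeasure a r) =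
      ENNReal.ofReal ((r / (r - z)) ^ a) := by
  have hrz : 0 < r - z := sub_pos.2 hz
  have hm : ∀ s, Measurable (gammaPDF a s) := fun s => (measurable_gammaPDFReal a s).ennreal_ofReal
  rw [gammaMeasure, lintegral_withDensity_eq_lintegral_mul _ (hm r) (by fun_prop)]
  have h : ∀ y, (gammaPDF a r * fun y => ENNReal.ofReal (Real.exp (z * y))) y =
      ENNReal.ofReal ((r / (r - z)) ^ a) * gammaPDF a (r - z) y := by
    intro y
    rw [Pi.mul_apply, gammaPDF, gammaPDF, ← ENNReal.ofReal_mul (gammaPDFReal_nonneg ha hr y),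
      ← ENNReal.ofReal_mul (by positivity)]
    congr 1
    unfold gammaPDFReal
    split_ifs
    · rw [Real.div_rpow hr.le hrz.le]
      have hE : Real.exp (-((r - z) * y)) = Real.exp (-(r * y)) * Real.exp (z * y) := by
        rw [← Real.exp_add]; congr 1; ring
      have h1 : (r - z) ^ a ≠ 0 := (Real.rpow_pos_of_pos hrz a).ne'
      rw [hE]
      field_simp
    · simp
  simp_rw [h]
  rw [lintegral_const_mul _ (hm _), lintegral_gammaPDF_eq_one ha hrz, mul_one]

lemma ae_nonneg_gammaMeasure (a r : ℝ) : ∀ᵐ y ∂(gammaMeasure a r), 0 ≤ y := by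
  have hm : Measurable (gammaPDF a r) := (measurable_gammaPDFReal a r).ennreal_ofReal
  rw [gammaMeasure, ae_withDensity_iff hm]
  refine ae_of_all _ fun y hy => ?_
  by_contra h
  exact hy (gammaPDF_of_neg (not_le.1 h))

/-- The law lives on `[0, ∞)`, so the moment increases with the exponent, and the finite moments
below `r` blow up at `r`. -/
lemma lintegral_exp_gammaMeasure_of_le {a r z : ℝ} (ha : 0 < a) (hr : 0 < r) (hz : r ≤ z) :
    ∫⁻ y, ENNReal.ofReal (Real.exp (z * y)) ∂(gammaMeasure a r) = ⊤ := by
  refine ENNReal.eq_top_of_forall_nnreal_le fun K => ?_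
  have hK : (0 : ℝ) < ((K : ℝ) + 1) ^ (1 / a) := by positivity
  -- The exponent below `r` at which the moment equals exactly `K + 1`.
  set s : ℝ := r - r / ((K : ℝ) + 1) ^ (1 / a) with hs
  have hsr : s < r := sub_lt_self _ (by positivity)
  have h1 : (r / (r - s)) ^ a = (K : ℝ) + 1 := by
    rw [hs, sub_sub_cancel, div_div_cancel₀ hr.ne', ← Real.rpow_mul (by positivity),
      one_div_mul_cancel ha.ne', Real.rpow_one]
  calc (K : ℝ≥0∞) ≤ ENNReal.ofReal ((r / (r - s)) ^ a) := by
        rw [h1, ← ENNReal.ofReal_coe_nnreal]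
        exact ENNReal.ofReal_le_ofReal (by linarith)
    _ = ∫⁻ y, ENNReal.ofReal (Real.exp (s * y)) ∂(gammaMeasure a r) :=
        (lintegral_exp_gammaMeasure_of_lt ha hr hsr).symm
    _ ≤ _ := by
        refine lintegral_mono_ae ?_
        filter_upwards [ae_nonneg_gammaMeasure a r] with y hy
        gcongr
        exact hsr.le.trans hz

lemma lintegral_exp_bilateralGamma {αp lamp αm lamm : ℝ} (hαp : 0 < αp) (hlamp : 0 < lamp)
    (hαm : 0 < αm) (hlamm : 0 < lamm) (z : ℝ) :
    ∫⁻ x, ENNReal.ofReal (Real.exp (z * x)) ∂(bilateralGamma αp lamp αm lamm) =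
      (∫⁻ y, ENNReal.ofReal (Real.exp (z * y)) ∂(gammaMeasure αp lamp)) *
        ∫⁻ y, ENNReal.ofReal (Real.exp (-z * y)) ∂(gammaMeasure αm lamm) := by
  have := isProbabilityMeasure_gammaMeasure hαp hlamp
  have := isProbabilityMeasure_gammaMeasure hαm hlamm
  rw [bilateralGamma, lintegral_map (by fun_prop) (by fun_prop),
    ← lintegral_prod_mul (by fun_prop) (by fun_prop)]
  refine lintegral_congr fun y => ?_
  rw [← ENNReal.ofReal_mul (Real.exp_pos _).le, ← Real.exp_add]
  congr 2
  ring

lemma lintegral_exp_bilateralGamma_of_mem {αp lamp αm lamm z : ℝ} (hαp : 0 < αp) (hlamp : 0 < lamp)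
    (hαm : 0 < αm) (hlamm : 0 < lamm) (hz : z ∈ Ioo (-lamm) lamp) :
    ∫⁻ x, ENNReal.ofReal (Real.exp (z * x)) ∂(bilateralGamma αp lamp αm lamm) =
      ENNReal.ofReal ((lamp / (lamp - z)) ^ αp * (lamm / (lamm + z)) ^ αm) := by
  have h1 : 0 < lamp - z := sub_pos.2 hz.2
  rw [lintegral_exp_bilateralGamma hαp hlamp hαm hlamm,
    lintegral_exp_gammaMeasure_of_lt hαp hlamp hz.2,
    lintegral_exp_gammaMeasure_of_lt hαm hlamm (by linarith [hz.1]), sub_neg_eq_add,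
    ← ENNReal.ofReal_mul (by positivity)]

lemma lintegral_exp_bilateralGamma_of_le {αp lamp αm lamm z : ℝ} (hαp : 0 < αp) (hlamp : 0 < lamp)
    (hαm : 0 < αm) (hlamm : 0 < lamm) (hz : lamp ≤ z) :
    ∫⁻ x, ENNReal.ofReal (Real.exp (z * x)) ∂(bilateralGamma αp lamp αm lamm) = ⊤ := by
  rw [lintegral_exp_bilateralGamma hαp hlamp hαm hlamm,
    lintegral_exp_gammaMeasure_of_le hαp hlamp hz,
    lintegral_exp_gammaMeasure_of_lt hαm hlamm (by linarith)]
  refine ENNReal.top_mul ?_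
  have : 0 < lamm - -z := by linarith
  rw [ne_eq, ENNReal.ofReal_eq_zero, not_le]
  positivity

/-! ### Exponential moments of the Lévy process -/

section LevyProcess

variable {Ω : Type*} {mΩ : MeasurableSpace Ω} {P : Measure Ω} {𝓕 : Filtration ℝ≥0 mΩ}
  {X : ℝ≥0 → Ω → ℝ} {αp lamp αm lamm : ℝ}

lemma IsLevyProcess.measurable (hX : IsLevyProcess 𝓕 P X) (t : ℝ≥0) : Measurable[𝓕 t] (X t) :=
  (hX.adapted t).measurable

lemma IsLevyProcess.measurable' (hX : IsLevyProcess 𝓕 P X) (t : ℝ≥0) : Measurable (X t) :=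
  (hX.measurable t).mono (𝓕.le t) le_rfl

lemma IsBilateralGammaProcess.lintegral_exp_one
    (hX : IsBilateralGammaProcess 𝓕 P X αp lamp αm lamm) (z : ℝ) :
    ∫⁻ ω, ENNReal.ofReal (Real.exp (z * X 1 ω)) ∂P =
      ∫⁻ x, ENNReal.ofReal (Real.exp (z * x)) ∂(bilateralGamma αp lamp αm lamm) := by
  rw [← hX.law_one, lintegral_map (by fun_prop) (hX.levy.measurable' 1)]

/-- The cumulant generating function of a bilateral Gamma process at time one. -/
lemma IsBilateralGammaProcess.cgf_one (hX : IsBilateralGammaProcess 𝓕 P X αp lamp αm lamm)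
    (hαp : 0 < αp) (hlamp : 0 < lamp) (hαm : 0 < αm) (hlamm : 0 < lamm) {z : ℝ}
    (hz : z ∈ Ioo (-lamm) lamp) :
    cgf (X 1) P z = αp * (Real.log lamp - Real.log (lamp - z)) +
      αm * (Real.log lamm - Real.log (lamm + z)) := by
  have h1 : 0 < lamp - z := sub_pos.2 hz.2
  have h2 : 0 < lamm + z := by linarith [hz.1]
  have hmX := hX.levy.measurable' 1
  rw [cgf, mgf, integral_eq_lintegral_of_nonneg_ae (ae_of_all _ fun _ => (Real.exp_pos _).le)
    (by fun_prop), hX.lintegral_exp_one,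
    lintegral_exp_bilateralGamma_of_mem hαp hlamp hαm hlamm hz,
    ENNReal.toReal_ofReal (by positivity), Real.log_mul (by positivity) (by positivity),
    Real.log_rpow (by positivity), Real.log_rpow (by positivity),
    Real.log_div hlamp.ne' h1.ne', Real.log_div hlamm.ne' h2.ne']

/-- Independent stationary increments. The identity is stated in `ℝ≥0∞` because it is needed when
the moments are infinite. -/
lemma IsLevyProcess.lintegral_exp_add [IsProbabilityMeasure P] (hX : IsLevyProcess 𝓕 P X)
    (z : ℝ) (s h : ℝ≥0) :
    ∫⁻ ω, ENNReal.ofReal (Real.exp (z * X (s + h) ω)) ∂P =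
      (∫⁻ ω, ENNReal.ofReal (Real.exp (z * X s ω)) ∂P) *
        ∫⁻ ω, ENNReal.ofReal (Real.exp (z * X h ω)) ∂P := by
  have hm := hX.measurable'
  have hE : Measurable fun x : ℝ => ENNReal.ofReal (Real.exp (z * x)) := by fun_prop
  have h1 : ∫⁻ ω, ENNReal.ofReal (Real.exp (z * X h ω)) ∂P =
      ∫⁻ ω, ENNReal.ofReal (Real.exp (z * (X (s + h) ω - X s ω))) ∂P := by
    have := congrArg (fun μ : Measure ℝ => ∫⁻ x, ENNReal.ofReal (Real.exp (z * x)) ∂μ)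
      (hX.stationary_increments s h)
    beta_reduce at this
    rw [lintegral_map hE (by fun_prop), lintegral_map hE (by fun_prop)] at this
    rw [this]
    refine lintegral_congr_ae ?_
    filter_upwards [hX.zero] with ω hω
    rw [hω, sub_zero]
  have h2 := lintegral_mul_eq_lintegral_mul_lintegral_of_independent_measurableSpace
    (𝓕.le s) ((hm (s + h)).sub (hm s)).comap_le (hX.indep_increments s h)
    (hE.comp (hX.measurable s)) (hE.comp (comap_measurable _))
  rw [h1]
  refine Eq.trans ?_ h2
  refine lintegral_congr fun ω => ?_
  rw [Function.comp_apply, Function.comp_apply, Pi.sub_apply,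
    ← ENNReal.ofReal_mul (Real.exp_pos _).le, ← Real.exp_add]
  congr 2
  ring

lemma IsLevyProcess.lintegral_exp_nsmul [IsProbabilityMeasure P] (hX : IsLevyProcess 𝓕 P X)
    (z : ℝ) (h : ℝ≥0) (n : ℕ) :
    ∫⁻ ω, ENNReal.ofReal (Real.exp (z * X (n • h) ω)) ∂P =
      (∫⁻ ω, ENNReal.ofReal (Real.exp (z * X h ω)) ∂P) ^ n := by
  induction n with
  | zero =>
    rw [zero_smul, pow_zero, ← measure_univ (μ := P), ← lintegral_one]
    refine lintegral_congr_ae ?_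
    filter_upwards [hX.zero] with ω hω
    simp [hω]
  | succ n ih => rw [succ_nsmul, hX.lintegral_exp_add, ih, pow_succ]

/-- Exponential moments of order at least `λ⁺` are infinite at arbitrarily small times. -/
lemma IsBilateralGammaProcess.lintegral_exp_inv_eq_top [IsProbabilityMeasure P]
    (hX : IsBilateralGammaProcess 𝓕 P X αp lamp αm lamm)
    (hαp : 0 < αp) (hlamp : 0 < lamp) (hαm : 0 < αm) (hlamm : 0 < lamm) {z : ℝ}
    (hz : lamp ≤ z) (n : ℕ) :
    ∫⁻ ω, ENNReal.ofReal (Real.exp (z * X (1 / ((n : ℝ≥0) + 1)) ω)) ∂P = ⊤ := by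
  have h := hX.levy.lintegral_exp_nsmul z (1 / ((n : ℝ≥0) + 1)) (n + 1)
  have h1 : (n + 1) • (1 / ((n : ℝ≥0) + 1)) = 1 := by
    rw [nsmul_eq_mul]; push_cast; field_simp
  rw [h1, hX.lintegral_exp_one, lintegral_exp_bilateralGamma_of_le hαp hlamp hαm hlamm hz] at h
  by_contra hne
  exact ENNReal.pow_ne_top hne h.symm

end LevyProcess

/-! ### Optional stopping in continuous time, by discretization -/

section OptionalStopping

variable {Ω : Type*} {mΩ : MeasurableSpace Ω} {𝓕 : Filtration ℝ≥0 mΩ} {Q : Measure Ω}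

/-- The approximation of the time `s ≤ t` from above on the grid of mesh `1 / (n + 1)`, as a
function of the index of the grid point. -/
noncomputable def gridTime (t : ℝ≥0) (n j : ℕ) : ℝ≥0 := min t ((j : ℝ≥0) / ((n : ℝ≥0) + 1))

lemma le_gridTime_iff {s t : ℝ≥0} (hst : s ≤ t) (n j : ℕ) :
    s ≤ gridTime t n j ↔ ⌈s * ((n : ℝ≥0) + 1)⌉₊ ≤ j := by
  have hn : (0 : ℝ≥0) < (n : ℝ≥0) + 1 := by positivity
  rw [gridTime, le_min_iff, Nat.ceil_le, le_div_iff₀ hn]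
  exact and_iff_right hst

lemma tendsto_gridTime {s t : ℝ≥0} (hst : s ≤ t) :
    Tendsto (fun n : ℕ => gridTime t n ⌈s * ((n : ℝ≥0) + 1)⌉₊) atTop (𝓝[≥] s) := by
  have hle : ∀ n : ℕ, s ≤ gridTime t n ⌈s * ((n : ℝ≥0) + 1)⌉₊ :=
    fun n => (le_gridTime_iff hst n _).2 le_rfl
  refine tendsto_nhdsWithin_iff.2 ⟨?_, Eventually.of_forall hle⟩
  have hlim : Tendsto (fun n : ℕ => s + 1 / ((n : ℝ≥0) + 1)) atTop (𝓝 (s + 0)) :=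
    tendsto_const_nhds.add tendsto_one_div_add_atTop_nhds_zero_nat
  rw [add_zero] at hlim
  refine tendsto_of_tendsto_of_tendsto_of_le_of_le tendsto_const_nhds hlim hle fun n => ?_
  have hn : (0 : ℝ≥0) < (n : ℝ≥0) + 1 := by positivity
  refine (min_le_right _ _).trans ?_
  rw [div_le_iff₀ hn, add_mul, one_div_mul_cancel hn.ne']
  exact (Nat.ceil_lt_add_one zero_le).le

variable {σ : Ω → ℝ≥0} {t : ℝ≥0}

/-- The index is at most `i` exactly when `σ` is at most the `i`-th grid time, so the value of the
index is decided by that time: the rounded-up time is again a stopping time. -/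
lemma measurableSet_gridIndex_eq (hσt : ∀ ω, σ ω ≤ t)
    (hσ : ∀ s, MeasurableSet[𝓕 s] {ω | σ ω ≤ s}) (n j : ℕ) :
    MeasurableSet[𝓕 (gridTime t n j)] {ω | ⌈σ ω * ((n : ℝ≥0) + 1)⌉₊ = j} := by
  have h : ∀ i, {ω | ⌈σ ω * ((n : ℝ≥0) + 1)⌉₊ ≤ i} = {ω | σ ω ≤ gridTime t n i} := fun i => by
    ext ω
    exact (le_gridTime_iff (hσt ω) n i).symm
  have h' : {ω | ⌈σ ω * ((n : ℝ≥0) + 1)⌉₊ = j} = {ω | σ ω ≤ gridTime t n j} \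
      ⋃ i ∈ Iio j, {ω | σ ω ≤ gridTime t n i} := by
    simp_rw [← h]
    ext ω
    simp only [mem_ofPred_eq, Set.mem_sdiff, mem_iUnion, mem_Iio, not_exists, not_le]
    constructor
    · rintro rfl
      exact ⟨le_rfl, fun i hi => hi⟩
    · rintro ⟨h1, h2⟩
      by_contra hne
      exact lt_irrefl _ (h2 _ (lt_of_le_of_ne h1 hne))
  rw [h']
  refine (hσ _).diff (MeasurableSet.biUnion (to_countable _) fun i hi => ?_)
  refine 𝓕.mono ?_ _ (hσ _)
  unfold gridTime
  gcongr
  exact (mem_Iio.1 hi).le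

variable {N : ℝ≥0 → Ω → ℝ≥0∞}

lemma measurable_comp_nat {J : Ω → ℕ} (hJ : ∀ j, MeasurableSet {ω | J ω = j}) {f : ℕ → Ω → ℝ≥0∞}
    (hf : ∀ j, Measurable (f j)) : Measurable fun ω => f (J ω) ω := by
  have hJ' : Measurable J := measurable_to_countable' hJ
  have h2 : Measurable fun p : ℕ × Ω => f p.1 p.2 := measurable_from_prod_countable_right hf
  exact h2.comp (hJ'.prodMk measurable_id)

lemma measurable_gridTime (hσt : ∀ ω, σ ω ≤ t) (hσ : ∀ s, MeasurableSet[𝓕 s] {ω | σ ω ≤ s})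
    (hN : ∀ s, Measurable (N s)) (n : ℕ) :
    Measurable fun ω => N (gridTime t n ⌈σ ω * ((n : ℝ≥0) + 1)⌉₊) ω := by
  exact measurable_comp_nat (f := fun j => N (gridTime t n j))
    (fun j => 𝓕.le _ _ (measurableSet_gridIndex_eq hσt hσ n j)) fun j => hN _

/-- Split `Ω` by the grid index; on each piece the time is deterministic and the martingale identity
applies. -/
lemma lintegral_gridTime (hσt : ∀ ω, σ ω ≤ t) (hσ : ∀ s, MeasurableSet[𝓕 s] {ω | σ ω ≤ s})
    (hmart : ∀ s ≤ t, ∀ A, MeasurableSet[𝓕 s] A → ∫⁻ ω in A, N s ω ∂Q = ∫⁻ ω in A, N t ω ∂Q)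
    (n : ℕ) :
    ∫⁻ ω, N (gridTime t n ⌈σ ω * ((n : ℝ≥0) + 1)⌉₊) ω ∂Q = ∫⁻ ω, N t ω ∂Q := by
  set A : ℕ → Set Ω := fun j => {ω | ⌈σ ω * ((n : ℝ≥0) + 1)⌉₊ = j} with hA
  have hAm := measurableSet_gridIndex_eq hσt hσ n
  have hU : (⋃ j, A j) = univ := by ext; simp [hA]
  have hd : Pairwise (Function.onFun Disjoint A) := fun i j hij =>
    Set.disjoint_left.2 fun ω h1 h2 => hij (h1.symm.trans h2)
  have hAm' : ∀ j, MeasurableSet (A j) := fun j => 𝓕.le _ _ (hAm j)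
  rw [← setLIntegral_univ, ← setLIntegral_univ (N t), ← hU, lintegral_iUnion hAm' hd,
    lintegral_iUnion hAm' hd]
  refine tsum_congr fun j => ?_
  rw [← hmart (gridTime t n j) (min_le_left _ _) _ (hAm j)]
  refine setLIntegral_congr_fun (hAm' j) fun ω hω => ?_
  have : ⌈σ ω * ((n : ℝ≥0) + 1)⌉₊ = j := hω
  simp only [this]

lemma tendsto_gridTime_of_rightContinuous (hσt : ∀ ω, σ ω ≤ t)
    (hrc : ∀ ω s, ContinuousWithinAt (fun u => N u ω) (Ici s) s) (ω : Ω) :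
    Tendsto (fun n : ℕ => N (gridTime t n ⌈σ ω * ((n : ℝ≥0) + 1)⌉₊) ω) atTop
      (𝓝 (N (σ ω) ω)) :=
  (hrc ω (σ ω)).tendsto.comp (tendsto_gridTime (hσt ω))

lemma measurable_stopped_of_rightContinuous (hσt : ∀ ω, σ ω ≤ t)
    (hσ : ∀ s, MeasurableSet[𝓕 s] {ω | σ ω ≤ s}) (hN : ∀ s, Measurable (N s))
    (hrc : ∀ ω s, ContinuousWithinAt (fun u => N u ω) (Ici s) s) :
    Measurable fun ω => N (σ ω) ω :=
  measurable_of_tendsto_metrizable (measurable_gridTime hσt hσ hN)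
    (tendsto_pi_nhds.2 (tendsto_gridTime_of_rightContinuous hσt hrc))

/-- Optional stopping inequality for nonnegative right-continuous martingales. -/
lemma lintegral_stopped_le_of_rightContinuous (hσt : ∀ ω, σ ω ≤ t)
    (hσ : ∀ s, MeasurableSet[𝓕 s] {ω | σ ω ≤ s}) (hN : ∀ s, Measurable (N s))
    (hrc : ∀ ω s, ContinuousWithinAt (fun u => N u ω) (Ici s) s)
    (hmart : ∀ s ≤ t, ∀ A, MeasurableSet[𝓕 s] A → ∫⁻ ω in A, N s ω ∂Q = ∫⁻ ω in A, N t ω ∂Q) :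
    ∫⁻ ω, N (σ ω) ω ∂Q ≤ ∫⁻ ω, N t ω ∂Q := by
  calc ∫⁻ ω, N (σ ω) ω ∂Q
      = ∫⁻ ω, liminf (fun n : ℕ => N (gridTime t n ⌈σ ω * ((n : ℝ≥0) + 1)⌉₊) ω) atTop ∂Q :=
        lintegral_congr fun ω =>
          (tendsto_gridTime_of_rightContinuous hσt hrc ω).liminf_eq.symm
    _ ≤ liminf (fun n : ℕ => ∫⁻ ω, N (gridTime t n ⌈σ ω * ((n : ℝ≥0) + 1)⌉₊) ω ∂Q) atTop :=
        lintegral_liminf_le (measurable_gridTime hσt hσ hN)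
    _ = ∫⁻ ω, N t ω ∂Q := by
        simp_rw [lintegral_gridTime hσt hσ hmart, liminf_const]

end OptionalStopping

/-! ### Nonnegative local martingales -/

section LocalMartingale

variable {Ω : Type*} {mΩ : MeasurableSpace Ω} {𝓕 : Filtration ℝ≥0 mΩ} {Q : Measure Ω}
  {Y : ℝ≥0 → Ω → ℝ} {T : WithTop ℝ≥0}

/-- The localized martingale has equal means at times `0` and `t`. Up to time `T` the stopping at
`T` is invisible, and the indicator in the localization restricts both means to `{⊥ < τ}`. -/
lemma setLIntegral_stopped_eq_of_martingale [IsProbabilityMeasure Q] {τ : Ω → WithTop ℝ≥0}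
    (hτ : IsStoppingTime 𝓕 τ) (hY : ∀ t ω, 0 ≤ Y t ω)
    (hM : Martingale (stoppedProcess (fun i => {ω | ⊥ < τ ω}.indicator
      (stoppedProcess Y (fun _ => T) i)) τ) 𝓕 Q) {t : ℝ≥0} (ht : (t : WithTop ℝ≥0) ≤ T) :
    ∫⁻ ω in {ω | ⊥ < τ ω}, ENNReal.ofReal (Y (min (t : WithTop ℝ≥0) (τ ω)).untopA ω) ∂Q =
      ∫⁻ ω in {ω | ⊥ < τ ω}, ENNReal.ofReal (Y 0 ω) ∂Q := by
  have hS : MeasurableSet {ω | ⊥ < τ ω} := 𝓕.le _ _ (hτ.measurableSet_gt 0)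
  have key : ∀ s : ℝ≥0, (s : WithTop ℝ≥0) ≤ T →
      stoppedProcess (fun i => {ω | ⊥ < τ ω}.indicator (stoppedProcess Y (fun _ => T) i)) τ s =
      {ω | ⊥ < τ ω}.indicator fun ω => Y (min (s : WithTop ℝ≥0) (τ ω)).untopA ω := by
    intro s hs
    ext ω
    have hne : min (s : WithTop ℝ≥0) (τ ω) ≠ ⊤ := ne_top_of_le_ne_top WithTop.coe_ne_top
      (min_le_left _ _)
    simp only [stoppedProcess, indicator]
    split_ifs
    · rw [WithTop.untopA_eq_untop hne, WithTop.coe_untop,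
        min_eq_left ((min_le_left _ _).trans hs)]
      rw [WithTop.untopA_eq_untop hne]
    · rfl
  have h0T : ((0 : ℝ≥0) : WithTop ℝ≥0) ≤ T := zero_le
  have hcongr : ∀ s : ℝ≥0, (s : WithTop ℝ≥0) ≤ T →
      ∫⁻ ω in {ω | ⊥ < τ ω}, ENNReal.ofReal (Y (min (s : WithTop ℝ≥0) (τ ω)).untopA ω) ∂Q =
      ENNReal.ofReal (∫ ω, stoppedProcess (fun i => {ω | ⊥ < τ ω}.indicator
        (stoppedProcess Y (fun _ => T) i)) τ s ω ∂Q) := by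
    intro s hs
    rw [ofReal_integral_eq_lintegral_ofReal (hM.integrable s), ← lintegral_indicator hS]
    · refine lintegral_congr fun ω => ?_
      rw [key s hs]
      simp only [indicator]
      split_ifs <;> simp
    · rw [key s hs]
      exact ae_of_all _ fun ω => indicator_nonneg (fun _ _ => hY _ _) _
  have hint : ∫ ω, stoppedProcess (fun i => {ω | ⊥ < τ ω}.indicator
        (stoppedProcess Y (fun _ => T) i)) τ t ω ∂Q =
      ∫ ω, stoppedProcess (fun i => {ω | ⊥ < τ ω}.indicator
        (stoppedProcess Y (fun _ => T) i)) τ 0 ω ∂Q := by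
    have := hM.setIntegral_eq (zero_le (a := t)) MeasurableSet.univ
    rw [setIntegral_univ, setIntegral_univ] at this
    exact this.symm
  rw [hcongr t ht, hint, ← hcongr 0 h0T]
  refine lintegral_congr fun ω => ?_
  have : min ((0 : ℝ≥0) : WithTop ℝ≥0) (τ ω) = ((0 : ℝ≥0) : WithTop ℝ≥0) :=
    min_eq_left zero_le
  rw [this, WithTop.untopA_eq_untop WithTop.coe_ne_top,
    WithTop.untop_coe]

/-- A nonnegative local martingale satisfies `E[Y t] ≤ c` if `Y 0 = c`. -/
lemma lintegral_le_of_isLocalMartingale [IsProbabilityMeasure Q] (hYm : ∀ t, Measurable (Y t))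
    (hY : ∀ t ω, 0 ≤ Y t ω) (hL : IsLocalMartingale 𝓕 Q (stoppedProcess Y (fun _ => T)))
    {c : ℝ} (h0 : ∀ᵐ ω ∂Q, Y 0 ω = c) {t : ℝ≥0} (ht : (t : WithTop ℝ≥0) ≤ T) :
    ∫⁻ ω, ENNReal.ofReal (Y t ω) ∂Q ≤ ENNReal.ofReal c := by
  obtain ⟨τ, hτ, hM⟩ := hL
  have hA : ∀ n, MeasurableSet {ω | (t : WithTop ℝ≥0) < τ n ω} := fun n =>
    𝓕.le _ _ ((hτ.isStoppingTime n).measurableSet_gt t)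
  -- Fatou's lemma along the events `{t < τ n}`, on which the stopped process still equals `Y t`.
  calc ∫⁻ ω, ENNReal.ofReal (Y t ω) ∂Q
      = ∫⁻ ω, liminf (fun n => {ω | (t : WithTop ℝ≥0) < τ n ω}.indicator
          (fun ω => ENNReal.ofReal (Y t ω)) ω) atTop ∂Q := by
        refine lintegral_congr_ae ?_
        filter_upwards [hτ.tendsto_top] with ω hω
        have hev : ∀ᶠ n in atTop, (t : WithTop ℝ≥0) < τ n ω :=
          hω.eventually (lt_mem_nhds (WithTop.coe_lt_top t))
        refine (Tendsto.liminf_eq ?_).symm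
        refine tendsto_const_nhds.congr' ?_
        filter_upwards [hev] with n hn
        rw [indicator_of_mem (show ω ∈ {ω | (t : WithTop ℝ≥0) < τ n ω} from hn)]
    _ ≤ liminf (fun n => ∫⁻ ω, {ω | (t : WithTop ℝ≥0) < τ n ω}.indicator
          (fun ω => ENNReal.ofReal (Y t ω)) ω ∂Q) atTop :=
        lintegral_liminf_le fun n => (hYm t).ennreal_ofReal.indicator (hA n)
    _ ≤ liminf (fun _ : ℕ => ENNReal.ofReal c) atTop := by
        refine liminf_le_liminf (Eventually.of_forall fun n => ?_)
        have hS : MeasurableSet {ω | ⊥ < τ n ω} :=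
          𝓕.le _ _ ((hτ.isStoppingTime n).measurableSet_gt 0)
        calc _ ≤ ∫⁻ ω in {ω | ⊥ < τ n ω},
              ENNReal.ofReal (Y (min (t : WithTop ℝ≥0) (τ n ω)).untopA ω) ∂Q := by
              rw [← lintegral_indicator hS]
              refine lintegral_mono fun ω => ?_
              by_cases h : (t : WithTop ℝ≥0) < τ n ω
              · have h' : ω ∈ {ω | ⊥ < τ n ω} := lt_of_le_of_lt bot_le h
                rw [indicator_of_mem (show ω ∈ {ω | (t : WithTop ℝ≥0) < τ n ω} from h),
                  indicator_of_mem h', min_eq_left h.le, WithTop.untopA_eq_untop WithTop.coe_ne_top,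
    WithTop.untop_coe]
              · rw [indicator_of_notMem (show ω ∉ {ω | (t : WithTop ℝ≥0) < τ n ω} from h)]
                exact zero_le
          _ = ∫⁻ ω in {ω | ⊥ < τ n ω}, ENNReal.ofReal (Y 0 ω) ∂Q :=
              setLIntegral_stopped_eq_of_martingale (hτ.isStoppingTime n) hY (hM n) ht
          _ ≤ ∫⁻ ω, ENNReal.ofReal (Y 0 ω) ∂Q := setLIntegral_le_lintegral _ _
          _ = ENNReal.ofReal c := by
              rw [lintegral_congr_ae (g := fun _ => ENNReal.ofReal c)
                (by filter_upwards [h0] with ω hω; rw [hω]), lintegral_const, measure_univ,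
                mul_one]
    _ = ENNReal.ofReal c := liminf_const _

end LocalMartingale

/-! ### The function `Φ` and the martingale equation -/

section Phi

variable {αp lamp αm lamm r q θ : ℝ}

lemma one_lt_div_sub_one {u : ℝ} (hu : 1 < u) : 1 < u / (u - 1) :=
  (one_lt_div (sub_pos.2 hu)).2 (sub_lt_self u one_pos)

/-- The left end point of `I` is where the base of the outer power in `Φ` equals one; on `I` that
base exceeds one, so the inverted term is positive. -/
lemma mem_phiDomain_iff (hαp : 0 < αp) (hrq : q ≤ r) :
    θ ∈ phiDomain αp lamp r q ↔
      θ < lamp - 1 ∧ r - q < αp * Real.log ((lamp - θ) / (lamp - θ - 1)) := by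
  rw [phiDomain, mem_ofPred_eq, and_comm]
  refine and_congr_right fun hθ => ?_
  have hu : 1 < lamp - θ := by linarith
  have hg := one_lt_div_sub_one hu
  have h1 : 0 < lamp - θ - 1 := by linarith
  have hlog : 0 < Real.log ((lamp - θ) / (lamp - θ - 1)) := Real.log_pos hg
  rcases hrq.eq_or_lt with rfl | hlt
  · simp only [true_or, sub_self, true_iff]
    positivity
  · have hρ : 0 < r - q := sub_pos.2 hlt
    have he : Real.exp (-((r - q) / αp)) < 1 := Real.exp_lt_one_iff.2 (by
      rw [neg_lt_zero]; positivity)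
    have he' : 0 < 1 - Real.exp (-((r - q) / αp)) := sub_pos.2 he
    rw [or_iff_right hlt.ne', sub_lt_comm, ← one_div, lt_div_iff₀ he', ← div_lt_iff₀' hαp,
      Real.lt_log_iff_exp_lt (by positivity), lt_div_iff₀ h1, Real.exp_neg]
    set E := Real.exp ((r - q) / αp) with hE
    have hEpos : 0 < E := Real.exp_pos _
    rw [← mul_lt_mul_iff_left₀ hEpos]
    have : (lamp - θ) * (1 - E⁻¹) * E = (lamp - θ) * E - (lamp - θ) := by
      field_simp
    rw [this]
    constructor <;> intro h <;> linarith

lemma phi_eq_exp (hθ : θ < lamp - 1) :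
    phi αp lamp αm lamm r q θ = lamm -
      (Real.exp ((αp * Real.log ((lamp - θ) / (lamp - θ - 1)) - (r - q)) / αm) - 1)⁻¹ := by
  have hg : 0 < (lamp - θ) / (lamp - θ - 1) :=
    one_pos.trans (one_lt_div_sub_one (by linarith))
  rw [phi, Real.rpow_def_of_pos hg, ← Real.exp_add, ← Real.exp_mul]
  congr 4
  ring

lemma log_ratio_lt {θ' : ℝ} (h : θ < θ') (hθ' : θ' < lamp - 1) :
    Real.log ((lamp - θ) / (lamp - θ - 1)) < Real.log ((lamp - θ') / (lamp - θ' - 1)) := by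
  have h1 : 0 < lamp - θ' - 1 := by linarith
  have h2 : 0 < lamp - θ - 1 := by linarith
  refine Real.log_lt_log (div_pos (by linarith) h2) ?_
  rw [div_lt_div_iff₀ h2 h1]
  nlinarith

lemma exp_sub_one_pos_of_mem_phiDomain (hαp : 0 < αp) (hαm : 0 < αm) (hrq : q ≤ r)
    (hθ : θ ∈ phiDomain αp lamp r q) :
    0 < Real.exp ((αp * Real.log ((lamp - θ) / (lamp - θ - 1)) - (r - q)) / αm) - 1 := by
  obtain ⟨-, h2⟩ := (mem_phiDomain_iff hαp hrq).1 hθ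
  rw [sub_pos, Real.one_lt_exp_iff]
  exact div_pos (sub_pos.2 h2) hαm

lemma strictMonoOn_phi (hαp : 0 < αp) (hαm : 0 < αm) (hrq : q ≤ r) :
    StrictMonoOn (phi αp lamp αm lamm r q) (phiDomain αp lamp r q) := by
  intro θ hθ θ' hθ' hlt
  have h1 := exp_sub_one_pos_of_mem_phiDomain hαp hαm hrq hθ
  rw [phi_eq_exp hθ.2, phi_eq_exp hθ'.2]
  have := log_ratio_lt hlt hθ'.2
  gcongr

lemma mapsTo_phi (hαp : 0 < αp) (hαm : 0 < αm) (hrq : q ≤ r) :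
    MapsTo (phi αp lamp αm lamm r q) (phiDomain αp lamp r q) (Iio lamm) := by
  intro θ hθ
  have h1 := exp_sub_one_pos_of_mem_phiDomain hαp hαm hrq hθ
  rw [phi_eq_exp hθ.2, mem_Iio]
  exact sub_lt_self _ (inv_pos.2 h1)

/-- The equation `Φ(θ) = -θ` on `I` is the martingale equation. -/
lemma phi_eq_neg_iff (hαp : 0 < αp) (hαm : 0 < αm) (hrq : q ≤ r) :
    (θ ∈ phiDomain αp lamp r q ∧ phi αp lamp αm lamm r q θ = -θ) ↔
      θ ∈ Ioo (-lamm) (lamp - 1) ∧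
        αp * (Real.log (lamp - θ) - Real.log (lamp - θ - 1)) -
          αm * (Real.log (lamm + θ + 1) - Real.log (lamm + θ)) = r - q := by
  by_cases hθ : θ < lamp - 1
  swap
  · exact ⟨fun h => absurd h.1.2 hθ, fun h => absurd h.1.2 hθ⟩
  have h1 : 0 < lamp - θ - 1 := by linarith
  have h2 : 0 < lamp - θ := by linarith
  rw [← Real.log_div h2.ne' h1.ne']
  have key : ∀ hpos : 0 < lamm + θ,
      (αp * Real.log ((lamp - θ) / (lamp - θ - 1)) -
          αm * (Real.log (lamm + θ + 1) - Real.log (lamm + θ)) = r - q ↔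
        Real.exp ((αp * Real.log ((lamp - θ) / (lamp - θ - 1)) - (r - q)) / αm) - 1
          = (lamm + θ)⁻¹) := by
    intro hpos
    have hpos' : 0 < lamm + θ + 1 := by linarith
    rw [← Real.log_div hpos'.ne' hpos.ne', sub_eq_iff_eq_add, sub_eq_iff_eq_add]
    have : (lamm + θ)⁻¹ + 1 = (lamm + θ + 1) / (lamm + θ) := by field_simp; ring
    rw [this, ← Real.exp_log (div_pos hpos' hpos), Real.exp_eq_exp, div_eq_iff hαm.ne',
      Real.log_exp]
    constructor <;> intro h <;> linarith
  constructor
  · rintro ⟨hI, he⟩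
    have hB := exp_sub_one_pos_of_mem_phiDomain hαp hαm hrq hI
    rw [phi_eq_exp hθ] at he
    have he' : (Real.exp ((αp * Real.log ((lamp - θ) / (lamp - θ - 1)) - (r - q)) / αm) - 1)⁻¹
        = lamm + θ := by linarith
    have hpos : 0 < lamm + θ := he' ▸ inv_pos.2 hB
    refine ⟨⟨by linarith, hθ⟩, (key hpos).2 ?_⟩
    rw [← he', inv_inv]
  · rintro ⟨⟨hl, -⟩, he⟩
    have hpos : 0 < lamm + θ := by linarith
    refine ⟨(mem_phiDomain_iff hαp hrq).2 ⟨hθ, ?_⟩, ?_⟩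
    · have : Real.log (lamm + θ) < Real.log (lamm + θ + 1) := Real.log_lt_log hpos (by linarith)
      have := mul_pos hαm (sub_pos.2 this)
      linarith
    · rw [phi_eq_exp hθ, (key hpos).1 he, inv_inv]
      ring

/-- A strictly increasing function meets the decreasing function `-θ` at most once. -/
lemma eq_of_phi_eq_neg (hαp : 0 < αp) (hαm : 0 < αm) (hrq : q ≤ r) {θ' : ℝ}
    (hθ : θ ∈ phiDomain αp lamp r q) (h : phi αp lamp αm lamm r q θ = -θ)
    (hθ' : θ' ∈ phiDomain αp lamp r q) (h' : phi αp lamp αm lamm r q θ' = -θ') : θ' = θ := by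
  have hm := strictMonoOn_phi (lamp := lamp) (lamm := lamm) hαp hαm hrq
  rcases lt_trichotomy θ' θ with hlt | rfl | hlt
  · have := hm hθ' hθ hlt
    linarith
  · rfl
  · have := hm hθ hθ' hlt
    linarith

/-- Intermediate value theorem: exactly one logarithm diverges at each end of the interval, driving
the expression to `-∞` on the left and to `∞` on the right. -/
lemma exists_martingale_equation (hαp : 0 < αp) (hαm : 0 < αm) (hlam : 1 < lamp + lamm) (ρ : ℝ) :
    ∃ θ ∈ Ioo (-lamm) (lamp - 1),
      αp * (Real.log (lamp - θ) - Real.log (lamp - θ - 1)) -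
          αm * (Real.log (lamm + θ + 1) - Real.log (lamm + θ)) = ρ := by
  have hlt : -lamm < lamp - 1 := by linarith
  have hlogbot : ∀ {l : Filter ℝ} {f : ℝ → ℝ}, Tendsto f l (𝓝[>] 0) →
      Tendsto (fun x => Real.log (f x)) l atBot := fun h => Real.tendsto_log_nhdsGT_zero.comp h
  have hcont : ContinuousOn (fun θ : ℝ => αp * (Real.log (lamp - θ) - Real.log (lamp - θ - 1)) -
          αm * (Real.log (lamm + θ + 1) - Real.log (lamm + θ))) (Ioo (-lamm) (lamp - 1)) := by
    have h : ∀ θ ∈ Ioo (-lamm) (lamp - 1), lamp - θ ≠ 0 ∧ lamp - θ - 1 ≠ 0 ∧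
        lamm + θ + 1 ≠ 0 ∧ lamm + θ ≠ 0 := fun θ hθ =>
      ⟨by linarith [hθ.2], by linarith [hθ.2], by linarith [hθ.1], by linarith [hθ.1]⟩
    refine ContinuousOn.sub (ContinuousOn.mul continuousOn_const (ContinuousOn.sub ?_ ?_))
      (ContinuousOn.mul continuousOn_const (ContinuousOn.sub ?_ ?_))
    · exact ContinuousOn.log (by fun_prop) fun θ hθ => (h θ hθ).1
    · exact ContinuousOn.log (by fun_prop) fun θ hθ => (h θ hθ).2.1
    · exact ContinuousOn.log (by fun_prop) fun θ hθ => (h θ hθ).2.2.1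
    · exact ContinuousOn.log (by fun_prop) fun θ hθ => (h θ hθ).2.2.2
  have hl₁ : 𝓝[>] (-lamm) ≤ 𝓟 (Ioo (-lamm) (lamp - 1)) :=
    le_principal_iff.2 (Ioo_mem_nhdsGT hlt)
  have hl₂ : 𝓝[<] (lamp - 1) ≤ 𝓟 (Ioo (-lamm) (lamp - 1)) :=
    le_principal_iff.2 (Ioo_mem_nhdsLT hlt)
  have ht₁ : Tendsto (fun θ : ℝ => αp * (Real.log (lamp - θ) - Real.log (lamp - θ - 1)) -
          αm * (Real.log (lamm + θ + 1) - Real.log (lamm + θ))) (𝓝[>] (-lamm)) atBot := by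
    have ha : Tendsto (fun θ : ℝ => lamm + θ) (𝓝[>] (-lamm)) (𝓝[>] 0) := by
      refine tendsto_nhdsWithin_iff.2 ⟨?_, ?_⟩
      · have : ContinuousAt (fun θ : ℝ => lamm + θ) (-lamm) := by fun_prop
        have h := this.tendsto
        rw [add_neg_cancel] at h
        exact h.mono_left nhdsWithin_le_nhds
      · filter_upwards [self_mem_nhdsWithin] with θ hθ
        have : -lamm < θ := hθ
        exact mem_Ioi.2 (by linarith)
    have hb : ContinuousAt (fun θ : ℝ => αp * (Real.log (lamp - θ) - Real.log (lamp - θ - 1)) -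
        αm * Real.log (lamm + θ + 1)) (-lamm) := by
      have e1 : lamp - -lamm ≠ 0 := by linarith
      have e2 : lamp - -lamm - 1 ≠ 0 := by linarith
      have e3 : lamm + -lamm + 1 ≠ 0 := by norm_num
      fun_prop (disch := assumption)
    refine (((hlogbot ha).const_mul_atBot hαm).atBot_add
      (hb.tendsto.mono_left nhdsWithin_le_nhds)).congr fun θ => ?_
    ring
  have ht₂ : Tendsto (fun θ : ℝ => αp * (Real.log (lamp - θ) - Real.log (lamp - θ - 1)) -
          αm * (Real.log (lamm + θ + 1) - Real.log (lamm + θ))) (𝓝[<] (lamp - 1)) atTop := by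
    have ha : Tendsto (fun θ : ℝ => lamp - θ - 1) (𝓝[<] (lamp - 1)) (𝓝[>] 0) := by
      refine tendsto_nhdsWithin_iff.2 ⟨?_, ?_⟩
      · have : ContinuousAt (fun θ : ℝ => lamp - θ - 1) (lamp - 1) := by fun_prop
        have h := this.tendsto
        rw [show lamp - (lamp - 1) - 1 = 0 by ring] at h
        exact h.mono_left nhdsWithin_le_nhds
      · filter_upwards [self_mem_nhdsWithin] with θ hθ
        have : θ < lamp - 1 := hθ
        exact mem_Ioi.2 (by linarith)
    have hb : ContinuousAt (fun θ : ℝ => αp * Real.log (lamp - θ) -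
        αm * (Real.log (lamm + θ + 1) - Real.log (lamm + θ))) (lamp - 1) := by
      have e1 : lamp - (lamp - 1) ≠ 0 := by norm_num
      have e2 : lamm + (lamp - 1) + 1 ≠ 0 := by linarith
      have e3 : lamm + (lamp - 1) ≠ 0 := by linarith
      fun_prop (disch := assumption)
    refine (((hlogbot ha).const_mul_atBot_of_neg (neg_lt_zero.2 hαp)).atTop_add
      (hb.tendsto.mono_left nhdsWithin_le_nhds)).congr fun θ => ?_
    ring
  obtain ⟨θ, hθ, h⟩ := isPreconnected_Ioo.intermediate_value_Iii hl₁ hl₂ hcont ht₁ ht₂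
    (mem_univ ρ)
  exact ⟨θ, hθ, h⟩

end Phi

/-! ### Esscher transforms and the martingale property of the discounted price -/

section Esscher

variable {Ω : Type*} {mΩ : MeasurableSpace Ω} {P Q Q' : Measure Ω} {𝓕 : Filtration ℝ≥0 mΩ}
  {X : ℝ≥0 → Ω → ℝ} {T : WithTop ℝ≥0} {Θ S₀ r q : ℝ}

lemma IsEsscherTransform.lintegral_eq (hQ : IsEsscherTransform 𝓕 T P X Θ Q)
    (hX : IsLevyProcess 𝓕 P X) {t : ℝ≥0} (ht : (t : WithTop ℝ≥0) ≤ T) {g : Ω → ℝ≥0∞}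
    (hg : Measurable[𝓕 t] g) :
    ∫⁻ ω, g ω ∂Q =
      ∫⁻ ω, ENNReal.ofReal (Real.exp (Θ * X t ω - cgf (X 1) P Θ * t)) * g ω ∂P := by
  have hXt := hX.measurable t
  have hD : Measurable[𝓕 t]
      fun ω => ENNReal.ofReal (Real.exp (Θ * X t ω - cgf (X 1) P Θ * t)) :=
    (Real.measurable_exp.comp ((hXt.const_mul Θ).sub_const _)).ennreal_ofReal
  -- The density is prescribed only on `𝓕 t`, so both measures are compared after restriction to
  -- that σ-algebra.
  have htrim : Q.trim (𝓕.le t) = (P.trim (𝓕.le t)).withDensity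
      fun ω => ENNReal.ofReal (Real.exp (Θ * X t ω - cgf (X 1) P Θ * t)) := by
    refine @Measure.ext _ (𝓕 t) _ _ fun A hA => ?_
    rw [trim_measurableSet_eq _ hA, withDensity_apply _ hA, restrict_trim _ _ hA,
      lintegral_trim _ hD, hQ.density t ht A hA]
  rw [← lintegral_trim (𝓕.le t) hg, htrim, lintegral_withDensity_eq_lintegral_mul _ hD hg,
    lintegral_trim _ (hD.mul hg)]
  rfl

lemma IsEsscherTransform.setLIntegral_eq (hQ : IsEsscherTransform 𝓕 T P X Θ Q)
    (hX : IsLevyProcess 𝓕 P X) {t : ℝ≥0} (ht : (t : WithTop ℝ≥0) ≤ T) {g : Ω → ℝ≥0∞}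
    (hg : Measurable[𝓕 t] g) {A : Set Ω} (hA : MeasurableSet[𝓕 t] A) :
    ∫⁻ ω in A, g ω ∂Q =
      ∫⁻ ω in A, ENNReal.ofReal (Real.exp (Θ * X t ω - cgf (X 1) P Θ * t)) * g ω ∂P := by
  rw [← lintegral_indicator (𝓕.le t A hA), ← lintegral_indicator (𝓕.le t A hA),
    hQ.lintegral_eq hX ht (hg.indicator hA)]
  refine lintegral_congr fun ω => ?_
  by_cases hω : ω ∈ A <;> simp [hω]

lemma IsEsscherTransform.isLocallyEquivalent (hQ : IsEsscherTransform 𝓕 T P X Θ Q)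
    (hX : IsLevyProcess 𝓕 P X) : IsLocallyEquivalent 𝓕 T Q P := by
  intro t ht A hA
  have hm := hX.measurable' t
  rw [hQ.density t ht A hA, lintegral_eq_zero_iff (by fun_prop), ← Measure.restrict_eq_zero,
    ← ae_eq_bot, ← eventually_false_iff_eq_bot]
  refine eventually_congr (ae_of_all _ fun ω => ?_)
  simp [Real.exp_pos]

/-- Passing from `P^Θ` to `P^{Θ + 1}` is the change of measure with density
`exp (X_t - (Ψ(Θ + 1) - Ψ(Θ)) t)`. -/
lemma IsEsscherTransform.setLIntegral_exp_eq (hQ : IsEsscherTransform 𝓕 T P X Θ Q)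
    (hQ' : IsEsscherTransform 𝓕 T P X (Θ + 1) Q') (hX : IsLevyProcess 𝓕 P X) {t : ℝ≥0}
    (ht : (t : WithTop ℝ≥0) ≤ T) {A : Set Ω} (hA : MeasurableSet[𝓕 t] A) :
    ∫⁻ ω in A, ENNReal.ofReal (Real.exp
        (X t ω - (cgf (X 1) P (Θ + 1) - cgf (X 1) P Θ) * t)) ∂Q = Q' A := by
  rw [hQ.setLIntegral_eq hX ht _ hA, hQ'.density t ht A hA]
  · refine lintegral_congr fun ω => ?_
    rw [← ENNReal.ofReal_mul (Real.exp_pos _).le, ← Real.exp_add]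
    congr 2
    ring
  · exact (Real.measurable_exp.comp ((hX.measurable t).sub_const _)).ennreal_ofReal

lemma ofReal_discountedPrice (hS₀ : 0 < S₀) (κ : ℝ) (t : ℝ≥0) (ω : Ω) :
    ENNReal.ofReal (discountedPrice S₀ r q X t ω) =
      ENNReal.ofReal (S₀ * Real.exp ((κ - (r - q)) * t)) *
        ENNReal.ofReal (Real.exp (X t ω - κ * t)) := by
  rw [← ENNReal.ofReal_mul (by positivity), discountedPrice, mul_left_comm, mul_assoc,
    ← Real.exp_add, ← Real.exp_add]
  congr 3
  ring

lemma discountedPrice_nonneg (hS₀ : 0 < S₀) (t : ℝ≥0) (ω : Ω) :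
    0 ≤ discountedPrice S₀ r q X t ω := by
  unfold discountedPrice
  positivity

lemma measurable_discountedPrice (hX : IsLevyProcess 𝓕 P X) (t : ℝ≥0) :
    Measurable[𝓕 t] (discountedPrice S₀ r q X t) :=
  ((Real.measurable_exp.comp (hX.measurable t)).const_mul S₀).const_mul _

lemma IsEsscherTransform.setLIntegral_discountedPrice (hQ : IsEsscherTransform 𝓕 T P X Θ Q)
    (hQ' : IsEsscherTransform 𝓕 T P X (Θ + 1) Q') (hX : IsLevyProcess 𝓕 P X) (hS₀ : 0 < S₀)
    {t : ℝ≥0} (ht : (t : WithTop ℝ≥0) ≤ T) {A : Set Ω} (hA : MeasurableSet[𝓕 t] A) :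
    ∫⁻ ω in A, ENNReal.ofReal (discountedPrice S₀ r q X t ω) ∂Q =
      ENNReal.ofReal
        (S₀ * Real.exp ((cgf (X 1) P (Θ + 1) - cgf (X 1) P Θ - (r - q)) * t)) * Q' A := by
  have hm := hX.measurable' t
  simp_rw [ofReal_discountedPrice hS₀ (cgf (X 1) P (Θ + 1) - cgf (X 1) P Θ)]
  rw [lintegral_const_mul _ (by fun_prop), hQ.setLIntegral_exp_eq hQ' hX ht hA]

lemma coe_untopA_min (T : WithTop ℝ≥0) (t : ℝ≥0) :
    (((min (t : WithTop ℝ≥0) T).untopA : ℝ≥0) : WithTop ℝ≥0) = min (t : WithTop ℝ≥0) T := by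
  have hne : min (t : WithTop ℝ≥0) T ≠ ⊤ :=
    ne_top_of_le_ne_top WithTop.coe_ne_top (min_le_left _ _)
  rw [WithTop.untopA_eq_untop hne, WithTop.coe_untop]

/-- If `Ψ(Θ + 1) - Ψ(Θ) = r - q`, then `P^Θ` is a martingale measure. -/
theorem IsEsscherTransform.isMartingaleMeasure (hQ : IsEsscherTransform 𝓕 T P X Θ Q)
    (hQ' : IsEsscherTransform 𝓕 T P X (Θ + 1) Q') (hX : IsLevyProcess 𝓕 P X) (hS₀ : 0 < S₀)
    (hκ : cgf (X 1) P (Θ + 1) - cgf (X 1) P Θ = r - q) :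
    IsMartingaleMeasure 𝓕 T P (discountedPrice S₀ r q X) Q := by
  have := hQ.isProbabilityMeasure
  have := hQ'.isProbabilityMeasure
  have hle : ∀ t : ℝ≥0, (min (t : WithTop ℝ≥0) T).untopA ≤ t := fun t => by
    rw [← WithTop.coe_le_coe, coe_untopA_min]
    exact min_le_left _ _
  have hleT : ∀ t : ℝ≥0, (((min (t : WithTop ℝ≥0) T).untopA : ℝ≥0) : WithTop ℝ≥0) ≤ T :=
    fun t => by
      rw [coe_untopA_min]
      exact min_le_right _ _
  have hm : ∀ t, Measurable (discountedPrice S₀ r q X t) := fun t =>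
    (measurable_discountedPrice hX t).mono (𝓕.le t) le_rfl
  -- The integral over `A` does not depend on `t`; this is the martingale property up to time `T`.
  have hl : ∀ t : ℝ≥0, (t : WithTop ℝ≥0) ≤ T → ∀ A, MeasurableSet[𝓕 t] A →
      ∫⁻ ω in A, ENNReal.ofReal (discountedPrice S₀ r q X t ω) ∂Q = ENNReal.ofReal S₀ * Q' A := by
    intro t ht A hA
    rw [hQ.setLIntegral_discountedPrice hQ' hX hS₀ ht hA, hκ, sub_self, zero_mul, Real.exp_zero,
      mul_one]
  have hint : ∀ t : ℝ≥0, (t : WithTop ℝ≥0) ≤ T → Integrable (discountedPrice S₀ r q X t) Q := by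
    intro t ht
    refine (lintegral_ofReal_ne_top_iff_integrable (hm t).aestronglyMeasurable
      (ae_of_all _ fun ω => discountedPrice_nonneg hS₀ t ω)).1 ?_
    rw [← setLIntegral_univ, hl t ht univ MeasurableSet.univ]
    exact ENNReal.mul_ne_top ENNReal.ofReal_ne_top (measure_ne_top _ _)
  refine ⟨hQ.isProbabilityMeasure, hQ.isLocallyEquivalent hX, Locally.of_prop ⟨?_, ?_⟩⟩
  · intro t
    exact ((measurable_discountedPrice hX _).mono (𝓕.mono (hle t)) le_rfl).stronglyMeasurable
  · intro i j hij
    refine (ae_eq_condExp_of_forall_setIntegral_eq (𝓕.le i) (hint _ (hleT j))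
      (fun A _ _ => (hint _ (hleT i)).integrableOn) (fun A hA _ => ?_)
      ((measurable_discountedPrice hX _).mono (𝓕.mono (hle i))
        le_rfl).stronglyMeasurable.aestronglyMeasurable).symm
    rcases le_or_gt (i : WithTop ℝ≥0) T with hi | hi
    · have hi' : (min (i : WithTop ℝ≥0) T).untopA = i := by
        rw [← WithTop.coe_inj, coe_untopA_min, min_eq_left hi]
      have hij' : i ≤ (min (j : WithTop ℝ≥0) T).untopA := by
        rw [← WithTop.coe_le_coe, coe_untopA_min]
        exact le_min (WithTop.coe_le_coe.2 hij) hi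
      simp only [hi']
      rw [integral_eq_lintegral_of_nonneg_ae
          (ae_of_all _ fun ω => discountedPrice_nonneg hS₀ _ ω) (hm _).aestronglyMeasurable,
        integral_eq_lintegral_of_nonneg_ae
          (ae_of_all _ fun ω => discountedPrice_nonneg hS₀ _ ω) (hm _).aestronglyMeasurable,
        hl i hi A hA, hl _ (hleT j) A (𝓕.mono hij' _ hA)]
    -- Past the horizon both times are frozen at `T`.
    · have hj : T < (j : WithTop ℝ≥0) := hi.trans_le (WithTop.coe_le_coe.2 hij)
      simp only [min_eq_right hi.le, min_eq_right hj.le]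

lemma IsMartingaleMeasure.ae_discountedPrice_zero (hX : IsLevyProcess 𝓕 P X)
    (h : IsMartingaleMeasure 𝓕 T P (discountedPrice S₀ r q X) Q) :
    ∀ᵐ ω ∂Q, discountedPrice S₀ r q X 0 ω = S₀ := by
  have hA : MeasurableSet[𝓕 0] {ω | ¬ X 0 ω = 0} :=
    (hX.measurable 0 (measurableSet_singleton 0)).compl
  have h0 : ∀ᵐ ω ∂Q, X 0 ω = 0 :=
    ae_iff.2 ((h.locallyEquivalent 0 zero_le _ hA).2 (ae_iff.1 hX.zero))
  filter_upwards [h0] with ω hω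
  simp [discountedPrice, hω]

lemma IsMartingaleMeasure.lintegral_discountedPrice_le (hX : IsLevyProcess 𝓕 P X) (hS₀ : 0 < S₀)
    (h : IsMartingaleMeasure 𝓕 T P (discountedPrice S₀ r q X) Q) {t : ℝ≥0}
    (ht : (t : WithTop ℝ≥0) ≤ T) :
    ∫⁻ ω, ENNReal.ofReal (discountedPrice S₀ r q X t ω) ∂Q ≤ ENNReal.ofReal S₀ := by
  have := h.isProbabilityMeasure
  exact lintegral_le_of_isLocalMartingale
    (fun t => (measurable_discountedPrice hX t).mono (𝓕.le t) le_rfl)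
    (discountedPrice_nonneg hS₀) h.localMartingale (h.ae_discountedPrice_zero hX) ht

/-- The horizon may be shorter than one, so the law of `X 1` has to be exploited through times `1 /
(n + 1)`. -/
lemma exists_one_div_le (hT : 0 < T) :
    ∃ n : ℕ, ((1 / ((n : ℝ≥0) + 1) : ℝ≥0) : WithTop ℝ≥0) ≤ T := by
  induction T with
  | top => exact ⟨0, le_top⟩
  | coe T =>
    obtain ⟨n, hn⟩ := exists_nat_one_div_lt (WithTop.coe_pos.1 hT)
    exact ⟨n, WithTop.coe_le_coe.2 hn.le⟩

/-- If `P^Θ` is a martingale measure, then `E[exp ((Θ + 1) X₁)]` is finite. -/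
lemma IsBilateralGammaProcess.add_one_lt_of_isMartingaleMeasure [IsProbabilityMeasure P]
    {αp lamp αm lamm : ℝ} (hX : IsBilateralGammaProcess 𝓕 P X αp lamp αm lamm)
    (hαp : 0 < αp) (hlamp : 0 < lamp) (hαm : 0 < αm) (hlamm : 0 < lamm) (hS₀ : 0 < S₀)
    (hT : 0 < T) (hQ : IsEsscherTransform 𝓕 T P X Θ Q)
    (h : IsMartingaleMeasure 𝓕 T P (discountedPrice S₀ r q X) Q) : Θ + 1 < lamp := by
  by_contra! hle
  obtain ⟨n, hn⟩ := exists_one_div_le hT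
  have htop := hX.lintegral_exp_inv_eq_top hαp hlamp hαm hlamm hle n
  set t : ℝ≥0 := 1 / ((n : ℝ≥0) + 1) with ht
  have hm := hX.levy.measurable' t
  have hfin := h.lintegral_discountedPrice_le hX.levy hS₀ hn
  rw [hQ.lintegral_eq hX.levy hn (measurable_discountedPrice hX.levy t).ennreal_ofReal] at hfin
  -- The Esscher density times the price is a positive constant times `exp ((Θ + 1) X_t)`, whose
  -- `P`-expectation is infinite.
  have heq : ∀ ω, ENNReal.ofReal (Real.exp (Θ * X t ω - cgf (X 1) P Θ * t)) *
      ENNReal.ofReal (discountedPrice S₀ r q X t ω) =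
      ENNReal.ofReal (S₀ * Real.exp (-(r - q) * t - cgf (X 1) P Θ * t)) *
        ENNReal.ofReal (Real.exp ((Θ + 1) * X t ω)) := by
    intro ω
    rw [← ENNReal.ofReal_mul (by positivity), ← ENNReal.ofReal_mul (by positivity),
      discountedPrice]
    congr 1
    rw [mul_left_comm (Real.exp (-(r - q) * t)), mul_left_comm, mul_assoc, ← Real.exp_add,
      ← Real.exp_add, ← Real.exp_add]
    congr 2
    ring
  simp_rw [heq] at hfin
  rw [lintegral_const_mul _ (by fun_prop), htop, ENNReal.mul_top] at hfin
  · exact absurd hfin (not_le.2 ENNReal.ofReal_lt_top)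
  · rw [ne_eq, ENNReal.ofReal_eq_zero, not_le]
    positivity

/-- If `P^Θ` is a martingale measure, then `Ψ(Θ + 1) - Ψ(Θ) = r - q`. -/
theorem IsEsscherTransform.cgf_sub_eq_of_isMartingaleMeasure
    (hQ : IsEsscherTransform 𝓕 T P X Θ Q)
    (hQ' : IsEsscherTransform 𝓕 T P X (Θ + 1) Q') (hX : IsLevyProcess 𝓕 P X) (hS₀ : 0 < S₀)
    (hT : 0 < T) (h : IsMartingaleMeasure 𝓕 T P (discountedPrice S₀ r q X) Q) :
    cgf (X 1) P (Θ + 1) - cgf (X 1) P Θ = r - q := by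
  have := hQ.isProbabilityMeasure
  have := hQ'.isProbabilityMeasure
  obtain ⟨n, ht⟩ := exists_one_div_le hT
  have ht0 : (0 : ℝ≥0) < 1 / ((n : ℝ≥0) + 1) := by positivity
  set t : ℝ≥0 := 1 / ((n : ℝ≥0) + 1)
  set κ := cgf (X 1) P (Θ + 1) - cgf (X 1) P Θ with hκ
  have ht0' : (0 : ℝ) < t := ht0
  refine le_antisymm ?_ ?_
  · have hle := h.lintegral_discountedPrice_le hX hS₀ ht
    rw [← setLIntegral_univ, hQ.setLIntegral_discountedPrice hQ' hX hS₀ ht MeasurableSet.univ,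
      measure_univ, mul_one, ENNReal.ofReal_le_ofReal_iff hS₀.le,
      mul_le_iff_le_one_right hS₀, Real.exp_le_one_iff] at hle
    have := nonpos_of_mul_nonpos_left hle ht0'
    linarith
  · by_contra! hlt
    set N : ℝ≥0 → Ω → ℝ≥0∞ := fun s ω => ENNReal.ofReal (Real.exp (X s ω - κ * s)) with hN
    have hNm : ∀ s, Measurable (N s) := fun s => by
      have := hX.measurable' s
      fun_prop
    have hNA : ∀ s ≤ t, ∀ A, MeasurableSet[𝓕 s] A → ∫⁻ ω in A, N s ω ∂Q = Q' A :=
      fun s hs A hA => hQ.setLIntegral_exp_eq hQ' hX ((WithTop.coe_le_coe.2 hs).trans ht) hA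
    have hrc : ∀ ω s, ContinuousWithinAt (fun u => N u ω) (Ici s) s := by
      intro ω s
      refine ENNReal.continuous_ofReal.continuousAt.comp_continuousWithinAt
        (Real.continuous_exp.continuousAt.comp_continuousWithinAt
          ((hX.right_continuous ω s).sub ?_))
      exact (continuous_const.mul NNReal.continuous_coe).continuousWithinAt
    obtain ⟨τ, hτ, hM⟩ := h.localMartingale
    have hY0 := h.ae_discountedPrice_zero hX
    -- Stop at `σ = min t (τ k)`. On `A` the price keeps mean `S₀`, although it is `S₀ N_σ` times a
    -- factor below one and `N_σ` has integral at most `Q A`; hence `A` is null.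
    have hzero : ∀ k, Q {ω | ⊥ < τ k ω} = 0 := by
      intro k
      have hst := hτ.isStoppingTime k
      set A : Set Ω := {ω | ⊥ < τ k ω} with hA
      have hA0 : MeasurableSet[𝓕 0] A := hst.measurableSet_gt 0
      have hAm : MeasurableSet A := 𝓕.le _ _ hA0
      set σ : Ω → ℝ≥0 := fun ω => (min (t : WithTop ℝ≥0) (τ k ω)).untopA with hσ
      have hσc : ∀ ω, ((σ ω : ℝ≥0) : WithTop ℝ≥0) = min (t : WithTop ℝ≥0) (τ k ω) :=
        fun ω => coe_untopA_min _ _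
      have hσt : ∀ ω, σ ω ≤ t := fun ω => by
        rw [← WithTop.coe_le_coe, hσc]
        exact min_le_left _ _
      have hσs : ∀ s, MeasurableSet[𝓕 s] {ω | σ ω ≤ s} := fun s => by
        have h1 : {ω | σ ω ≤ s} = {ω | min (τ k ω) (t : WithTop ℝ≥0) ≤ (s : WithTop ℝ≥0)} := by
          ext ω
          rw [mem_ofPred_eq, mem_ofPred_eq, ← WithTop.coe_le_coe, hσc, min_comm]
        rw [h1]
        exact hst.min_const t s
      have hNσm : Measurable fun ω => N (σ ω) ω :=
        measurable_stopped_of_rightContinuous hσt hσs hNm hrc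
      have hNσ : ∫⁻ ω, N (σ ω) ω ∂Q ≤ 1 := by
        refine (lintegral_stopped_le_of_rightContinuous hσt hσs hNm hrc
          fun s hs B hB => ?_).trans_eq ?_
        · rw [hNA s hs B hB, hNA t le_rfl B (𝓕.mono hs B hB)]
        · rw [← setLIntegral_univ, hNA t le_rfl univ MeasurableSet.univ, measure_univ]
      have hAc : ∫⁻ ω in Aᶜ, N (σ ω) ω ∂Q = Q Aᶜ := by
        rw [← setLIntegral_one]
        refine setLIntegral_congr_fun_ae hAm.compl ?_
        filter_upwards [hY0] with ω hω hωA
        have hσ0 : σ ω = 0 := by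
          rw [← WithTop.coe_inj, hσc]
          have : τ k ω = ⊥ := by simpa [hA] using hωA
          rw [this]
          exact min_eq_right bot_le
        have hX0 : Real.exp (X 0 ω) = 1 := by
          have h1 : S₀ * Real.exp (X 0 ω) = S₀ * 1 := by simpa [discountedPrice] using hω
          exact mul_left_cancel₀ hS₀.ne' h1
        simp only [hN, hσ0]
        simp [hX0]
      -- Off `A` the time `σ` is zero and `N = 1` a.s., so the global bound `1` leaves at most `Q A`
      -- for `A`.
      have hNA' : ∫⁻ ω in A, N (σ ω) ω ∂Q ≤ Q A := by
        have h1 : ∫⁻ ω in A, N (σ ω) ω ∂Q + Q Aᶜ ≤ Q A + Q Aᶜ := by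
          rw [← hAc, lintegral_add_compl _ hAm, hAc, measure_add_measure_compl hAm, measure_univ]
          exact hNσ
        exact (ENNReal.add_le_add_iff_right (measure_ne_top _ _)).1 h1
      have hY := setLIntegral_stopped_eq_of_martingale hst (discountedPrice_nonneg hS₀) (hM k) ht
      have hYA : ∫⁻ ω in A, ENNReal.ofReal (discountedPrice S₀ r q X 0 ω) ∂Q =
          ENNReal.ofReal S₀ * Q A := by
        rw [← setLIntegral_const]
        refine setLIntegral_congr_fun_ae hAm ?_
        filter_upwards [hY0] with ω hω _
        rw [hω]
      have hS : ENNReal.ofReal S₀ ≠ 0 := by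
        rw [ne_eq, ENNReal.ofReal_eq_zero, not_le]
        exact hS₀
      have hEq : ∫⁻ ω in A,
          ENNReal.ofReal (Real.exp ((κ - (r - q)) * σ ω)) * N (σ ω) ω ∂Q = Q A := by
        have h1 : ∀ ω, ENNReal.ofReal (discountedPrice S₀ r q X (σ ω) ω) =
            ENNReal.ofReal S₀ *
              (ENNReal.ofReal (Real.exp ((κ - (r - q)) * σ ω)) * N (σ ω) ω) := by
          intro ω
          rw [ofReal_discountedPrice hS₀ κ, ENNReal.ofReal_mul hS₀.le, mul_assoc]
        rw [hYA] at hY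
        change ∫⁻ ω in A, ENNReal.ofReal (discountedPrice S₀ r q X (σ ω) ω) ∂Q = _ at hY
        simp_rw [h1] at hY
        rw [lintegral_const_mul' _ _ ENNReal.ofReal_ne_top] at hY
        exact (ENNReal.mul_right_inj hS ENNReal.ofReal_ne_top).1 hY
      have hexp : ∀ ω, ENNReal.ofReal (Real.exp ((κ - (r - q)) * σ ω)) ≤ 1 := by
        intro ω
        rw [ENNReal.ofReal_le_one, Real.exp_le_one_iff]
        exact mul_nonpos_of_nonpos_of_nonneg (by linarith) (σ ω).2
      -- The discounted integrand lies below `N_σ` and its integral is not smaller, so they agree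
      -- a.e. on `A`; yet there `σ > 0` makes the factor strictly less than one.
      have hae := ae_eq_of_ae_le_of_lintegral_le (μ := Q.restrict A)
        (f := fun ω => ENNReal.ofReal (Real.exp ((κ - (r - q)) * σ ω)) * N (σ ω) ω)
        (g := fun ω => N (σ ω) ω) (ae_of_all _ fun ω => mul_le_of_le_one_left' (hexp ω))
        (by rw [hEq]; exact measure_ne_top _ _) hNσm.aemeasurable (by rw [hEq]; exact hNA')
      rw [EventuallyEq, ae_restrict_iff' hAm] at hae
      rw [measure_eq_zero_iff_ae_notMem]
      filter_upwards [hae] with ω hω hωA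
      have hσpos : (0 : ℝ) < σ ω := by
        have : (0 : ℝ≥0) < σ ω := by
          rw [← WithTop.coe_lt_coe, hσc]
          exact lt_min (WithTop.coe_lt_coe.2 ht0) hωA
        exact this
      have h1 := hω hωA
      have h2 : Real.exp ((κ - (r - q)) * σ ω) < 1 :=
        Real.exp_lt_one_iff.2 (mul_neg_of_neg_of_pos (by linarith) hσpos)
      simp only [hN] at h1
      rw [← ENNReal.ofReal_mul (Real.exp_pos _).le,
        ENNReal.ofReal_eq_ofReal_iff (by positivity) (by positivity)] at h1
      have h3 := mul_lt_of_lt_one_left (Real.exp_pos (X (σ ω) ω - κ * σ ω)) h2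
      exact absurd h1 h3.ne
    have hall : ∀ᵐ ω ∂Q, ∀ k, ω ∉ {ω | ⊥ < τ k ω} :=
      ae_all_iff.2 fun k => measure_eq_zero_iff_ae_notMem.1 (hzero k)
    have hfalse : ∀ᵐ ω ∂Q, False := by
      filter_upwards [hall, hτ.tendsto_top] with ω h1 h2
      obtain ⟨k, hk⟩ := (h2.eventually (lt_mem_nhds (WithTop.coe_lt_top (0 : ℝ≥0)))).exists
      exact h1 k hk
    simp at hfalse
    exact IsProbabilityMeasure.ne_zero Q hfalse

end Esscher

/-! ### The main theorem -/

theorem mainTheorem5 {Ω : Type*} {mΩ : MeasurableSpace Ω} (P : Measure Ω)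
    [IsProbabilityMeasure P] (𝓕 : Filtration ℝ≥0 mΩ) (X : ℝ≥0 → Ω → ℝ)
    (αp lamp αm lamm : ℝ) (hαp : 0 < αp) (hlamp : 0 < lamp) (hαm : 0 < αm) (hlamm : 0 < lamm)
    (hX : IsBilateralGammaProcess 𝓕 P X αp lamp αm lamm)
    (S₀ r q : ℝ) (hS₀ : 0 < S₀) (hq : 0 ≤ q) (hrq : q ≤ r)
    -- the time horizon; `T = ⊤` is the infinite horizon
    (T : WithTop ℝ≥0) (hT : 0 < T)
    -- `PE Θ` is the Esscher transform `P^Θ`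
    (PE : ℝ → Measure Ω)
    (hPE : ∀ Θ ∈ Ioo (-lamm) lamp, IsEsscherTransform 𝓕 T P X Θ (PE Θ))
    (hlam : 1 < lamp + lamm) :
    StrictMonoOn (phi αp lamp αm lamm r q) (phiDomain αp lamp r q) ∧
    MapsTo (phi αp lamp αm lamm r q) (phiDomain αp lamp r q) (Iio lamm) ∧
    ∃ Θ ∈ Ioo (-lamm) (lamp - 1),
      -- `Θ` is the unique parameter such that `P^Θ` is a martingale measure
      IsMartingaleMeasure 𝓕 T P (discountedPrice S₀ r q X) (PE Θ) ∧
      (∀ Θ' ∈ Ioo (-lamm) lamp,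
        IsMartingaleMeasure 𝓕 T P (discountedPrice S₀ r q X) (PE Θ') → Θ' = Θ) ∧
      -- `Θ` is the unique solution of `Φ(Θ) = -Θ`
      Θ ∈ phiDomain αp lamp r q ∧
      phi αp lamp αm lamm r q Θ = -Θ ∧
      (∀ Θ' ∈ phiDomain αp lamp r q, phi αp lamp αm lamm r q Θ' = -Θ' → Θ' = Θ) := by
  have hcgf : ∀ θ ∈ Ioo (-lamm) (lamp - 1), cgf (X 1) P (θ + 1) - cgf (X 1) P θ =
      αp * (Real.log (lamp - θ) - Real.log (lamp - θ - 1)) -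
        αm * (Real.log (lamm + θ + 1) - Real.log (lamm + θ)) := by
    intro θ hθ
    rw [hX.cgf_one hαp hlamp hαm hlamm (z := θ) ⟨hθ.1, by linarith [hθ.2]⟩,
      hX.cgf_one hαp hlamp hαm hlamm (z := θ + 1) ⟨by linarith [hθ.1], by linarith [hθ.2]⟩,
      ← sub_sub lamp θ 1, ← add_assoc lamm θ 1]
    ring
  have hE : ∀ θ ∈ Ioo (-lamm) (lamp - 1), IsEsscherTransform 𝓕 T P X θ (PE θ) ∧
      IsEsscherTransform 𝓕 T P X (θ + 1) (PE (θ + 1)) := fun θ hθ =>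
    ⟨hPE θ ⟨hθ.1, by linarith [hθ.2]⟩, hPE (θ + 1) ⟨by linarith [hθ.1], by linarith [hθ.2]⟩⟩
  obtain ⟨Θ, hΘ, heq⟩ := exists_martingale_equation (αp := αp) (αm := αm) hαp hαm hlam (r - q)
  obtain ⟨hΘI, hΘphi⟩ := (phi_eq_neg_iff hαp hαm hrq).2 ⟨hΘ, heq⟩
  have huniq : ∀ Θ' ∈ phiDomain αp lamp r q, phi αp lamp αm lamm r q Θ' = -Θ' → Θ' = Θ :=
    fun Θ' hΘ' h' => eq_of_phi_eq_neg hαp hαm hrq hΘI hΘphi hΘ' h'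
  refine ⟨strictMonoOn_phi hαp hαm hrq, mapsTo_phi hαp hαm hrq, Θ, hΘ,
    (hE Θ hΘ).1.isMartingaleMeasure (hE Θ hΘ).2 hX.levy hS₀ ((hcgf Θ hΘ).trans heq),
    fun Θ' hΘ' hmart => ?_, hΘI, hΘphi, huniq⟩
  -- This comes first: only for `Θ' + 1 < λ⁺` is `PE (Θ' + 1)` known to be an Esscher transform, as
  -- the martingale equation requires.
  have hlt := hX.add_one_lt_of_isMartingaleMeasure hαp hlamp hαm hlamm hS₀ hT (hPE Θ' hΘ') hmart
  have hΘ'' : Θ' ∈ Ioo (-lamm) (lamp - 1) := ⟨hΘ'.1, by linarith⟩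
  have hk := (hE Θ' hΘ'').1.cgf_sub_eq_of_isMartingaleMeasure (hE Θ' hΘ'').2 hX.levy hS₀ hT hmart
  rw [hcgf Θ' hΘ''] at hk
  obtain ⟨h1, h2⟩ := (phi_eq_neg_iff hαp hαm hrq).2 ⟨hΘ'', hk⟩
  exact huniq Θ' h1 h2
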